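/- Let $(\mathscr{C},\otimes,e,[-,-])$ be a closed symmetric monoidal category equipped with a model structure such that: (a) (symmetric monoidal model category) for all cofibrations $k:A\to B$ and $\ell:X\to Y$ the pushout-product $$k\odot\ell:\ (A\otimes Y)\amalg_{A\otimes X}(B\otimes X)\to B\otimes Y$$ is a cofibration, which is a weak equivalence if $k$ or $\ell$ is; (b) (combinatorial) $\mathscr{C}$ is locally presentable and the model structure is cofibrantly generated, i.e. there are (small) sets $\mathcal I,\mathcal J$ of maps such that the acyclic fibrations are the maps with the right lifting property with respect to $\mathcal I$ and the fibrations are the maps with the right lifting property with respect to $\mathcal J$; (c) (Schwede–Shipley monoid axiom) every transfinite composition of cobase changes of maps of the form $k\otimes\mathrm{id}_Z:A\otimes Z\to B\otimes Z$, with $k:A\to B$ an acyclic cofibration and $Z$ an object of $\mathscr{C}$, is a weak equivalence; (d) the map $\emptyset\to e$ from the initial object is a cofibration. A cubical monoid in $\mathscr{C}$ is an object $I$ with maps $d_0,d_1:e\to I$, $s:I\to e$ and $\mu:I\otimes I\to I$ such that $s d_0=s d_1=\mathrm{id}_e$; $\mu$ makes $I$ an associative monoid with two-sided unit $d_1$;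 $s$ is a map of monoids (where $e$ has its canonical monoid structure); and $d_0$ is absorbing, i.e., modulo $e\otimes e\cong e$, $\mu\circ(\mathrm{id}_I\otimes d_0)=d_0\circ(s\otimes\mathrm{id}_e)$ and $\mu\circ(d_0\otimes\mathrm{id}_I)=d_0\circ(\mathrm{id}_e\otimes s)$. Then $\mathscr{C}$ has a cubical monoid $$e\amalg e\xrightarrow{\,d_0\amalg d_1\,} I\xrightarrow{\ s\ } e$$ such that $d_0\amalg d_1$ (the map with components $d_0$ and $d_1$) is a cofibration and $s$ is a weak equivalence. -/

import Mathlib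

open CategoryTheory Limits MonoidalCategory HomotopicalAlgebra

universe v u

namespace CubicalModel

section CubicalMonoid

variable (C : Type u) [Category.{v} C] [MonoidalCategory C]

/-- A cubical monoid in a monoidal category with unit `e = 𝟙_ C`: an object `X` with maps
`d₀, d₁ : e ⟶ X` and `s : X ⟶ e` such that `d₀ ≫ s` and `d₁ ≫ s` are the identity of `e`,
together with an associative multiplication `μ : X ⊗ X ⟶ X` with two-sided unit `d₁`, such that
`s` is a map of monoids to `e` and `d₀` is absorbing on both sides. -/
structure CubicalMonoid where
  /-- the underlying object -/
  X : C
  d₀ : 𝟙_ C ⟶ X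
  d₁ : 𝟙_ C ⟶ X
  s : X ⟶ 𝟙_ C
  /-- the multiplication -/
  μ : X ⊗ X ⟶ X
  d₀_s : d₀ ≫ s = 𝟙 (𝟙_ C)
  d₁_s : d₁ ≫ s = 𝟙 (𝟙_ C)
  one_mul : d₁ ▷ X ≫ μ = (λ_ X).hom
  mul_one : X ◁ d₁ ≫ μ = (ρ_ X).hom
  mul_assoc : μ ▷ X ≫ μ = (α_ X X X).hom ≫ X ◁ μ ≫ μ
  /-- `s` is multiplicative (it is unital by `d₁_s`) -/
  mul_s : μ ≫ s = (s ⊗ₘ s) ≫ (λ_ (𝟙_ C)).hom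
  mul_d₀ : X ◁ d₀ ≫ μ = s ▷ 𝟙_ C ≫ (λ_ (𝟙_ C)).hom ≫ d₀
  d₀_mul : d₀ ▷ X ≫ μ = 𝟙_ C ◁ s ≫ (λ_ (𝟙_ C)).hom ≫ d₀

end CubicalMonoid

section ModelCategory

variable (C : Type u) [Category.{v} C] [ModelCategory C]

/-- A combinatorial model category: the underlying category is locally presentable, and the
model structure is cofibrantly generated by (small) sets `I` and `J` of maps. The domains of the
maps in `I` and `J` are automatically small, as every object of a locally presentable category is
presentable. -/
class IsCombinatorial : Prop extends IsLocallyPresentable.{v} C where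
  exists_generating_sets : ∃ I J : MorphismProperty C,
    MorphismProperty.IsSmall.{v} I ∧ MorphismProperty.IsSmall.{v} J ∧
      trivialFibrations C = I.rlp ∧ fibrations C = J.rlp

variable [MonoidalCategory C]

variable {C} in
/-- The pushout-product `(B ⊗ X) ⨿_{A ⊗ X} (A ⊗ Y) ⟶ B ⊗ Y` of `k : A ⟶ B` and `l : X ⟶ Y`. -/
noncomputable abbrev pushoutProductMap {A B X Y : C} (k : A ⟶ B) (l : X ⟶ Y) :
    pushout (k ▷ X) (A ◁ l) ⟶ B ⊗ Y :=
  pushout.desc (B ◁ l) (k ▷ Y) (whisker_exchange k l).symm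

/-- The pushout-product axiom: `⊗` is a left Quillen bifunctor. (It is used for closed monoidal
categories, in which `⊗` preserves colimits in each variable.) -/
class PushoutProductAxiom : Prop where
  cofibration {A B X Y : C} (k : A ⟶ B) (l : X ⟶ Y) [Cofibration k] [Cofibration l] :
    Cofibration (pushoutProductMap k l)
  weakEquivalence_left {A B X Y : C} (k : A ⟶ B) (l : X ⟶ Y) [Cofibration k] [Cofibration l]
    [WeakEquivalence k] : WeakEquivalence (pushoutProductMap k l)
  weakEquivalence_right {A B X Y : C} (k : A ⟶ B) (l : X ⟶ Y) [Cofibration k] [Cofibration l]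
    [WeakEquivalence l] : WeakEquivalence (pushoutProductMap k l)

/-- The class of all maps `k ▷ Z : A ⊗ Z ⟶ B ⊗ Z`, for `k : A ⟶ B` an acyclic cofibration and
`Z` an object. -/
inductive trivialCofibrationsTensor : MorphismProperty C
  | mk {A B : C} (k : A ⟶ B) (hk : trivialCofibrations C k) (Z : C) :
    trivialCofibrationsTensor (k ▷ Z)

/-- The Schwede–Shipley monoid axiom: every transfinite composition of cobase changes of maps
`A ⊗ Z ⟶ B ⊗ Z`, with `A ⟶ B` an acyclic cofibration and `Z` an object, is a weak equivalence. -/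
class MonoidAxiom : Prop where
  le_weakEquivalences :
    MorphismProperty.transfiniteCompositions.{v} (trivialCofibrationsTensor C).pushouts ≤
      weakEquivalences C

end ModelCategory

end CubicalModel

/-!
Factor the codiagonal `e ⨿ e ⟶ e` as a cofibration followed by an acyclic fibration, through an
object `X` with endpoints `d₀` and `d₁`. The cubical monoid is the James construction on `X`: the
free monoid on `X` in which the letter `d₁` is the unit and the letter `d₀` is an absorbing zero.
It is the union of objects of words of bounded length, and two facts make it work.

*Passing to longer words is a cofibration.* If `j : A ⟶ B` includes the words of length less than
`n` into those of length at most `n`, then words of length at most `n + 1` are products of an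
element of `B` by a letter, and such a product is already known if the letter is an endpoint or
the word lies in `A`. So `B ⟶ B'` is a cobase change of the pushout-product of `j` with
`e ⨿ e ⟶ X` (`JamesStage.next`), and is a cofibration by the pushout-product axiom
(`JamesStage.cofibration_next_j`). The chain begins with `e ⟶ e ⨿ e` (zero, then zero and the empty
word), which is a cofibration as `e` is cofibrant; hence `e ⨿ e ⟶ James` is one.

*The augmentation is a weak equivalence.* Right multiplication `M ⊗ X ⟶ M` by letters is a homotopy
between multiplication by `d₁`, the identity of `M`, and multiplication by `d₀`, which factors
through the augmentation `M ⟶ e`. As `M` is cofibrant, this contracts `M` onto `e`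
(`weakEquivalence_of_interval_homotopy`).

The multiplication `M ⊗ M ⟶ M` is defined by recursion on the length of the second factor
(`Interval.PartialMul.exists_succ`), which is possible because `M ⊗ -` preserves colimits. The
monoid laws follow from the fact that a map on `A ⊗ M` compatible with right multiplication by
letters is determined by its values on zero and on the empty word (`Interval.james_induction`).

Local presentability supplies the sequential colimit.
-/

namespace CubicalModel

/-! ### Maps out of tensor products with colimits -/

section

variable {C : Type u} [Category.{v} C] [MonoidalCategory C] [MonoidalClosed C]

section

variable [HasBinaryCoproducts C]

/-- The map out of `A ⊗ (Y ⨿ Z)` with given components: `A ⊗ -` preserves coproducts. -/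
noncomputable def tensorCoprodDesc {A Y Z W : C} (f : A ⊗ Y ⟶ W) (g : A ⊗ Z ⟶ W) :
    A ⊗ (Y ⨿ Z) ⟶ W :=
  MonoidalClosed.uncurry (coprod.desc (MonoidalClosed.curry f) (MonoidalClosed.curry g))

@[simp]
lemma whiskerLeft_inl_tensorCoprodDesc {A Y Z W : C} (f : A ⊗ Y ⟶ W) (g : A ⊗ Z ⟶ W) :
    A ◁ coprod.inl ≫ tensorCoprodDesc f g = f := by
  rw [tensorCoprodDesc, ← MonoidalClosed.uncurry_natural_left, coprod.inl_desc,
    MonoidalClosed.uncurry_curry]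

@[simp]
lemma whiskerLeft_inr_tensorCoprodDesc {A Y Z W : C} (f : A ⊗ Y ⟶ W) (g : A ⊗ Z ⟶ W) :
    A ◁ coprod.inr ≫ tensorCoprodDesc f g = g := by
  rw [tensorCoprodDesc, ← MonoidalClosed.uncurry_natural_left, coprod.inr_desc,
    MonoidalClosed.uncurry_curry]

lemma tensorCoprod_hom_ext {A Y Z W : C} {f g : A ⊗ (Y ⨿ Z) ⟶ W}
    (hl : A ◁ coprod.inl ≫ f = A ◁ coprod.inl ≫ g)
    (hr : A ◁ coprod.inr ≫ f = A ◁ coprod.inr ≫ g) : f = g := by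
  apply MonoidalClosed.curry_injective
  ext
  · simp only [← MonoidalClosed.curry_natural_left, hl]
  · simp only [← MonoidalClosed.curry_natural_left, hr]

end

section

variable [HasPushouts C]

/-- The map out of `A ⊗ P`, for a pushout `P`, with given compatible components: `A ⊗ -`
preserves pushouts. -/
noncomputable def tensorPushoutDesc {A X Y Z W : C} {f : X ⟶ Y} {g : X ⟶ Z}
    (a : A ⊗ Y ⟶ W) (b : A ⊗ Z ⟶ W) (h : A ◁ f ≫ a = A ◁ g ≫ b) : A ⊗ pushout f g ⟶ W :=
  MonoidalClosed.uncurry (pushout.desc (MonoidalClosed.curry a) (MonoidalClosed.curry b) (by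
    simp only [← MonoidalClosed.curry_natural_left, h]))

@[simp]
lemma whiskerLeft_inl_tensorPushoutDesc {A X Y Z W : C} {f : X ⟶ Y} {g : X ⟶ Z}
    (a : A ⊗ Y ⟶ W) (b : A ⊗ Z ⟶ W) (h : A ◁ f ≫ a = A ◁ g ≫ b) :
    A ◁ pushout.inl f g ≫ tensorPushoutDesc a b h = a := by
  rw [tensorPushoutDesc, ← MonoidalClosed.uncurry_natural_left, pushout.inl_desc,
    MonoidalClosed.uncurry_curry]

@[simp]
lemma whiskerLeft_inr_tensorPushoutDesc {A X Y Z W : C} {f : X ⟶ Y} {g : X ⟶ Z}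
    (a : A ⊗ Y ⟶ W) (b : A ⊗ Z ⟶ W) (h : A ◁ f ≫ a = A ◁ g ≫ b) :
    A ◁ pushout.inr f g ≫ tensorPushoutDesc a b h = b := by
  rw [tensorPushoutDesc, ← MonoidalClosed.uncurry_natural_left, pushout.inr_desc,
    MonoidalClosed.uncurry_curry]

lemma tensorPushout_hom_ext {A X Y Z W : C} {f : X ⟶ Y} {g : X ⟶ Z}
    {a b : A ⊗ pushout f g ⟶ W}
    (hl : A ◁ pushout.inl f g ≫ a = A ◁ pushout.inl f g ≫ b)
    (hr : A ◁ pushout.inr f g ≫ a = A ◁ pushout.inr f g ≫ b) : a = b := by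
  apply MonoidalClosed.curry_injective
  ext
  · simp only [← MonoidalClosed.curry_natural_left, hl]
  · simp only [← MonoidalClosed.curry_natural_left, hr]

end

end

/-! ### Intervals and stages of the James construction -/

section

variable {C : Type u} [Category.{v} C] [MonoidalCategory C]

variable (C) in
/-- An object `X` of a monoidal category with two endpoints `d₀, d₁ : e ⟶ X` and an augmentation
`s : X ⟶ e` that is a common retraction of the endpoints. -/
structure Interval where
  /-- the underlying object -/
  X : C
  d₀ : 𝟙_ C ⟶ X
  d₁ : 𝟙_ C ⟶ X
  s : X ⟶ 𝟙_ C
  d₀_s : d₀ ≫ s = 𝟙 (𝟙_ C)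
  d₁_s : d₁ ≫ s = 𝟙 (𝟙_ C)

/-- Two consecutive terms `j : A ⟶ B` of the word-length filtration of the James construction on
an interval `X`, over `e` by `s` and with zero `z`: `r` multiplies an element of `A` by a letter of `X` on
the right, the letter `d₁` acts as a unit, and both the letter `d₀` and the element `z` are
absorbing. -/
structure JamesStage (I : Interval C) where
  A : C
  B : C
  j : A ⟶ B
  r : A ⊗ I.X ⟶ B
  z : 𝟙_ C ⟶ A
  s : B ⟶ 𝟙_ C
  z_s : z ≫ j ≫ s = 𝟙 (𝟙_ C)
  r_one : A ◁ I.d₁ ≫ r = (ρ_ A).hom ≫ j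
  r_zero : A ◁ I.d₀ ≫ r = (ρ_ A).hom ≫ j ≫ s ≫ z ≫ j
  r_s : r ≫ s = ((j ≫ s) ⊗ₘ I.s) ≫ (λ_ (𝟙_ C)).hom
  z_r : z ▷ I.X ≫ r = (λ_ I.X).hom ≫ I.s ≫ z ≫ j

attribute [simp] JamesStage.z_s

namespace JamesStage

variable {I : Interval C}

section

variable [HasBinaryCoproducts C]

variable (I) in
/-- The start of the filtration: zero alone, included into zero together with the empty word. -/
noncomputable def initial : JamesStage I where
  A := 𝟙_ C
  B := 𝟙_ C ⨿ 𝟙_ C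
  j := coprod.inl
  r := (λ_ I.X).hom ≫ I.s ≫ coprod.inl
  z := 𝟙 _
  s := coprod.desc (𝟙 _) (𝟙 _)
  z_s := (Category.id_comp _).trans (coprod.inl_desc _ _)
  r_one := by
    rw [leftUnitor_naturality_assoc, reassoc_of% I.d₁_s, unitors_equal]
  r_zero := by
    have h : (coprod.inl : 𝟙_ C ⟶ 𝟙_ C ⨿ 𝟙_ C) ≫ coprod.desc (𝟙 _) (𝟙 _) = 𝟙 _ :=
      coprod.inl_desc _ _
    simp only [leftUnitor_naturality_assoc, reassoc_of% I.d₀_s, reassoc_of% h, Category.id_comp,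
      unitors_equal]
  r_s := by
    have h : (coprod.inl : 𝟙_ C ⟶ 𝟙_ C ⨿ 𝟙_ C) ≫ coprod.desc (𝟙 _) (𝟙 _) = 𝟙 _ :=
      coprod.inl_desc _ _
    simp only [Category.assoc, h, Category.comp_id, id_tensorHom, leftUnitor_naturality]
  z_r := by simp

variable (S : JamesStage I) [MonoidalClosed C]

/-- The action of the two endpoints on `B`, by zero and by the identity. -/
noncomputable def endpointAction : S.B ⊗ (𝟙_ C ⨿ 𝟙_ C) ⟶ S.B :=
  tensorCoprodDesc ((ρ_ S.B).hom ≫ S.s ≫ S.z ≫ S.j) (ρ_ S.B).hom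

lemma endpointAction_comp :
    S.j ▷ (𝟙_ C ⨿ 𝟙_ C) ≫ S.endpointAction = S.A ◁ coprod.desc I.d₀ I.d₁ ≫ S.r := by
  apply tensorCoprod_hom_ext
  · rw [← whiskerLeft_comp_assoc, coprod.inl_desc, S.r_zero, whisker_exchange_assoc,
      endpointAction, whiskerLeft_inl_tensorCoprodDesc, rightUnitor_naturality_assoc]
  · rw [← whiskerLeft_comp_assoc, coprod.inr_desc, S.r_one, whisker_exchange_assoc,
      endpointAction, whiskerLeft_inr_tensorCoprodDesc, rightUnitor_naturality]

end

end JamesStage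

end

/-! ### Lengthening words by one letter -/

section

variable {C : Type u} [Category.{v} C] [MonoidalCategory C] [MonoidalClosed C]
  [HasBinaryCoproducts C] [HasPushouts C]

namespace JamesStage

variable {I : Interval C} (S : JamesStage I)

/-- The corner `B ⊗ X ⟵ (B ⊗ (e ⨿ e)) ⨿ (A ⊗ X)`, namely the pushout-product of `A ⟶ B` and
`e ⨿ e ⟶ X`. -/
noncomputable abbrev corner :
    pushout (S.j ▷ (𝟙_ C ⨿ 𝟙_ C)) (S.A ◁ coprod.desc I.d₀ I.d₁) ⟶ S.B ⊗ I.X :=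
  pushout.desc (S.B ◁ coprod.desc I.d₀ I.d₁) (S.j ▷ I.X)
    (whisker_exchange S.j (coprod.desc I.d₀ I.d₁)).symm

/-- The products by a letter that are already known to be short: the last letter is an endpoint,
or the word itself lies in `A`. -/
noncomputable abbrev attach :
    pushout (S.j ▷ (𝟙_ C ⨿ 𝟙_ C)) (S.A ◁ coprod.desc I.d₀ I.d₁) ⟶ S.B :=
  pushout.desc S.endpointAction S.r S.endpointAction_comp

/-- The object of words longer by one letter. -/
noncomputable abbrev nextB : C := pushout S.corner S.attach

noncomputable abbrev nextj : S.B ⟶ S.nextB := pushout.inr _ _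

noncomputable abbrev nextr : S.B ⊗ I.X ⟶ S.nextB := pushout.inl _ _

lemma whiskerLeft_endpoint_nextr :
    S.B ◁ coprod.desc I.d₀ I.d₁ ≫ S.nextr = S.endpointAction ≫ S.nextj := by
  have := pushout.inl (S.j ▷ (𝟙_ C ⨿ 𝟙_ C)) (S.A ◁ coprod.desc I.d₀ I.d₁) ≫=
    (pushout.condition (f := S.corner) (g := S.attach))
  simpa only [pushout.inl_desc_assoc] using this

lemma whiskerRight_j_nextr : S.j ▷ I.X ≫ S.nextr = S.r ≫ S.nextj := by
  have := pushout.inr (S.j ▷ (𝟙_ C ⨿ 𝟙_ C)) (S.A ◁ coprod.desc I.d₀ I.d₁) ≫=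
    (pushout.condition (f := S.corner) (g := S.attach))
  simpa only [pushout.inr_desc_assoc] using this

lemma whiskerLeft_d₀_nextr :
    S.B ◁ I.d₀ ≫ S.nextr = (ρ_ S.B).hom ≫ S.s ≫ S.z ≫ S.j ≫ S.nextj := by
  have := S.B ◁ coprod.inl ≫= S.whiskerLeft_endpoint_nextr
  rwa [← whiskerLeft_comp_assoc, coprod.inl_desc, endpointAction,
    reassoc_of% whiskerLeft_inl_tensorCoprodDesc, Category.assoc, Category.assoc,
    Category.assoc] at this

lemma whiskerLeft_d₁_nextr : S.B ◁ I.d₁ ≫ S.nextr = (ρ_ S.B).hom ≫ S.nextj := by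
  have := S.B ◁ coprod.inr ≫= S.whiskerLeft_endpoint_nextr
  rwa [← whiskerLeft_comp_assoc, coprod.inr_desc, endpointAction,
    reassoc_of% whiskerLeft_inr_tensorCoprodDesc] at this

/-- To map `A' ⊗ nextB` to `W`, it suffices to give the values on shorter words and on products
by a letter, compatibly with the relations. -/
lemma exists_whiskerLeft_next {A' W : C} (a : A' ⊗ S.B ⟶ W) (b : A' ⊗ (S.B ⊗ I.X) ⟶ W)
    (h₀ : A' ◁ (S.B ◁ I.d₀) ≫ b = A' ◁ ((ρ_ S.B).hom ≫ S.s ≫ S.z ≫ S.j) ≫ a)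
    (h₁ : A' ◁ (S.B ◁ I.d₁) ≫ b = A' ◁ (ρ_ S.B).hom ≫ a)
    (hj : A' ◁ (S.j ▷ I.X) ≫ b = A' ◁ S.r ≫ a) :
    ∃ g : A' ⊗ S.nextB ⟶ W, A' ◁ S.nextj ≫ g = a ∧ A' ◁ S.nextr ≫ g = b := by
  -- the relations are checked on `A' ⊗ (B ⊗ e)`, once for each endpoint, and on `A' ⊗ (A ⊗ X)`
  refine ⟨tensorPushoutDesc b a ?_, whiskerLeft_inr_tensorPushoutDesc _ _ _,
    whiskerLeft_inl_tensorPushoutDesc _ _ _⟩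
  apply tensorPushout_hom_ext
  · simp only [← whiskerLeft_comp_assoc, pushout.inl_desc]
    rw [← cancel_epi (α_ _ _ _).hom]
    apply tensorCoprod_hom_ext
    · simp only [associator_naturality_right_assoc, ← whiskerLeft_comp_assoc,
        ← whiskerLeft_comp, coprod.inl_desc, h₀, endpointAction, whiskerLeft_inl_tensorCoprodDesc]
    · simp only [associator_naturality_right_assoc, ← whiskerLeft_comp_assoc,
        ← whiskerLeft_comp, coprod.inr_desc, h₁, endpointAction, whiskerLeft_inr_tensorCoprodDesc]
  · simp only [← whiskerLeft_comp_assoc, pushout.inr_desc, hj]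

/-- The augmentation of the longer words, by multiplicativity. -/
lemma exists_nexts : ∃ s : S.nextB ⟶ 𝟙_ C, S.nextj ≫ s = S.s ∧
    S.nextr ≫ s = (S.s ⊗ₘ I.s) ≫ (λ_ (𝟙_ C)).hom := by
  refine ⟨pushout.desc ((S.s ⊗ₘ I.s) ≫ (λ_ (𝟙_ C)).hom) S.s ?_, pushout.inr_desc _ _ _,
    pushout.inl_desc _ _ _⟩
  apply pushout.hom_ext
  · simp only [pushout.inl_desc_assoc]
    apply tensorCoprod_hom_ext
    · rw [← whiskerLeft_comp_assoc, coprod.inl_desc, endpointAction,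
        reassoc_of% whiskerLeft_inl_tensorCoprodDesc, whiskerLeft_comp_tensorHom_assoc, I.d₀_s]
      simp [unitors_equal]
    · rw [← whiskerLeft_comp_assoc, coprod.inr_desc, endpointAction,
        reassoc_of% whiskerLeft_inr_tensorCoprodDesc, whiskerLeft_comp_tensorHom_assoc, I.d₁_s]
      simp [unitors_equal]
  · simp only [pushout.inr_desc_assoc, S.r_s, whiskerRight_comp_tensorHom_assoc]

/-- The next stage of the word-length filtration. -/
noncomputable def next : JamesStage I where
  A := S.B
  B := S.nextB
  j := S.nextj
  r := S.nextr
  z := S.z ≫ S.j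
  s := S.exists_nexts.choose
  z_s := by simp [S.exists_nexts.choose_spec.1]
  r_one := S.whiskerLeft_d₁_nextr
  r_zero := by
    rw [S.whiskerLeft_d₀_nextr, reassoc_of% S.exists_nexts.choose_spec.1, Category.assoc]
  r_s := by rw [S.exists_nexts.choose_spec.1, S.exists_nexts.choose_spec.2]
  z_r := by
    rw [comp_whiskerRight_assoc, S.whiskerRight_j_nextr, reassoc_of% S.z_r, Category.assoc]

@[simp] lemma next_j_s : S.next.j ≫ S.next.s = S.s := S.exists_nexts.choose_spec.1

lemma cofibration_next_j [ModelCategory C] [PushoutProductAxiom C] [Cofibration S.j]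
    [Cofibration (coprod.desc I.d₀ I.d₁)] : Cofibration S.next.j := by
  have : Cofibration S.corner := PushoutProductAxiom.cofibration S.j (coprod.desc I.d₀ I.d₁)
  exact inferInstanceAs (Cofibration (pushout.inr S.corner S.attach))

end JamesStage

end

/-! ### The word-length filtration and partial products -/

section

variable {C : Type u} [Category.{v} C] [MonoidalCategory C] [MonoidalClosed C]
  [HasBinaryCoproducts C] [HasPushouts C]

namespace Interval

variable (I : Interval C)

/-- The stages of the word-length filtration of the James construction. -/
noncomputable def stage : ℕ → JamesStage I
  | 0 => JamesStage.initial I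
  | n + 1 => (stage n).next

/-- The object of words of length less than `n`, zero being counted as a word of every length. -/
noncomputable def word (n : ℕ) : C := (I.stage n).A

noncomputable def wordIncl (n : ℕ) : I.word n ⟶ I.word (n + 1) := (I.stage n).j

/-- Multiplication of a word by a letter on the right. -/
noncomputable def wordMul (n : ℕ) : I.word n ⊗ I.X ⟶ I.word (n + 1) := (I.stage n).r

noncomputable def wordZero (n : ℕ) : 𝟙_ C ⟶ I.word n := (I.stage n).z

/-- The augmentation of words, the product of the augmentations of the letters. -/
noncomputable def wordAug (n : ℕ) : I.word n ⟶ 𝟙_ C := (I.stage n).j ≫ (I.stage n).s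

lemma wordZero_wordIncl (n : ℕ) : I.wordZero n ≫ I.wordIncl n = I.wordZero (n + 1) := rfl

lemma wordZero_wordAug (n : ℕ) : I.wordZero n ≫ I.wordAug n = 𝟙 (𝟙_ C) := (I.stage n).z_s

lemma wordAug_succ (n : ℕ) : I.wordAug (n + 1) = (I.stage n).s := (I.stage n).next_j_s

lemma wordIncl_wordAug (n : ℕ) : I.wordIncl n ≫ I.wordAug (n + 1) = I.wordAug n := by
  rw [wordAug_succ]; rfl

lemma whiskerLeft_d₁_wordMul (n : ℕ) :
    I.word n ◁ I.d₁ ≫ I.wordMul n = (ρ_ (I.word n)).hom ≫ I.wordIncl n :=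
  (I.stage n).r_one

lemma whiskerLeft_d₀_wordMul (n : ℕ) : I.word n ◁ I.d₀ ≫ I.wordMul n =
    (ρ_ (I.word n)).hom ≫ I.wordAug n ≫ I.wordZero (n + 1) := by
  refine (I.stage n).r_zero.trans ?_
  exact congrArg ((ρ_ _).hom ≫ ·) (Category.assoc _ _ _).symm

lemma wordMul_wordAug (n : ℕ) :
    I.wordMul n ≫ I.wordAug (n + 1) = (I.wordAug n ⊗ₘ I.s) ≫ (λ_ (𝟙_ C)).hom := by
  rw [wordAug_succ]
  exact (I.stage n).r_s

lemma wordZero_whiskerRight_wordMul (n : ℕ) : I.wordZero n ▷ I.X ≫ I.wordMul n =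
    (λ_ I.X).hom ≫ I.s ≫ I.wordZero (n + 1) :=
  (I.stage n).z_r

lemma wordIncl_whiskerRight_wordMul (n : ℕ) :
    I.wordIncl n ▷ I.X ≫ I.wordMul (n + 1) = I.wordMul n ≫ I.wordIncl (n + 1) :=
  (I.stage n).whiskerRight_j_nextr

lemma exists_whiskerLeft_word {A W : C} (n : ℕ) (a : A ⊗ I.word (n + 1) ⟶ W)
    (b : A ⊗ (I.word (n + 1) ⊗ I.X) ⟶ W)
    (h₀ : A ◁ (I.word (n + 1) ◁ I.d₀) ≫ b =
      A ◁ ((ρ_ (I.word (n + 1))).hom ≫ I.wordAug (n + 1) ≫ I.wordZero (n + 1)) ≫ a)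
    (h₁ : A ◁ (I.word (n + 1) ◁ I.d₁) ≫ b = A ◁ (ρ_ (I.word (n + 1))).hom ≫ a)
    (hj : A ◁ (I.wordIncl n ▷ I.X) ≫ b = A ◁ I.wordMul n ≫ a) :
    ∃ g : A ⊗ I.word (n + 2) ⟶ W,
      A ◁ I.wordIncl (n + 1) ≫ g = a ∧ A ◁ I.wordMul (n + 1) ≫ g = b := by
  rw [wordAug_succ] at h₀
  exact (I.stage n).exists_whiskerLeft_next a b h₀ h₁ hj

lemma whiskerLeft_word_hom_ext {A W : C} (n : ℕ) {f g : A ⊗ I.word (n + 2) ⟶ W}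
    (hj : A ◁ I.wordIncl (n + 1) ≫ f = A ◁ I.wordIncl (n + 1) ≫ g)
    (hr : A ◁ I.wordMul (n + 1) ≫ f = A ◁ I.wordMul (n + 1) ≫ g) : f = g :=
  tensorPushout_hom_ext hr hj

/-- The empty word. -/
noncomputable def wordOne : 𝟙_ C ⟶ I.word 1 := (coprod.inr : 𝟙_ C ⟶ 𝟙_ C ⨿ 𝟙_ C)

lemma wordOne_wordAug : I.wordOne ≫ I.wordAug 1 = 𝟙 (𝟙_ C) := by
  rw [wordAug_succ]
  exact coprod.inr_desc _ _

lemma wordZero_one : I.wordZero 1 = (coprod.inl : 𝟙_ C ⟶ 𝟙_ C ⨿ 𝟙_ C) :=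
  Category.id_comp _

instance : IsIso (I.wordZero 0) := inferInstanceAs (IsIso (𝟙 (𝟙_ C)))

lemma exists_whiskerLeft_word_one {A W : C} (a b : A ⊗ 𝟙_ C ⟶ W) :
    ∃ f : A ⊗ I.word 1 ⟶ W, A ◁ I.wordZero 1 ≫ f = a ∧ A ◁ I.wordOne ≫ f = b := by
  rw [wordZero_one]
  exact ⟨tensorCoprodDesc a b, whiskerLeft_inl_tensorCoprodDesc _ _,
    whiskerLeft_inr_tensorCoprodDesc _ _⟩

lemma whiskerLeft_word_one_hom_ext {A W : C} {f g : A ⊗ I.word 1 ⟶ W}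
    (h₀ : A ◁ I.wordZero 1 ≫ f = A ◁ I.wordZero 1 ≫ g)
    (h₁ : A ◁ I.wordOne ≫ f = A ◁ I.wordOne ≫ g) : f = g := by
  rw [wordZero_one] at h₀
  exact tensorCoprod_hom_ext h₀ h₁

lemma cofibration_wordIncl [ModelCategory C] [PushoutProductAxiom C] [IsCofibrant (𝟙_ C)]
    [Cofibration (coprod.desc I.d₀ I.d₁)] (n : ℕ) : Cofibration (I.wordIncl n) := by
  induction n with
  | zero => exact inferInstanceAs (Cofibration (coprod.inl : 𝟙_ C ⟶ 𝟙_ C ⨿ 𝟙_ C))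
  | succ n hn =>
    have : Cofibration (I.stage n).j := hn
    exact (I.stage n).cofibration_next_j

/-- For an object `M` with zero `z`, augmentation `t` and a right action `r` of the letters, the
induced action of words, at two consecutive word lengths: `f₀` and `f₁` multiply an element of `M`
by a word. Both lengths are kept, since extending `f₁` to longer words requires knowing how it
restricts to the shorter ones and to products by a letter. -/
structure PartialMul {M : C} (z : 𝟙_ C ⟶ M) (t : M ⟶ 𝟙_ C) (r : M ⊗ I.X ⟶ M) (n : ℕ) where
  f₀ : M ⊗ I.word n ⟶ M
  f₁ : M ⊗ I.word (n + 1) ⟶ M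
  zero : M ◁ I.wordZero n ≫ f₀ = (ρ_ M).hom ≫ t ≫ z
  incl : M ◁ I.wordIncl n ≫ f₁ = f₀
  mul : M ◁ I.wordMul n ≫ f₁ = (α_ _ _ _).inv ≫ f₀ ▷ I.X ≫ r
  aug₁ : f₁ ≫ t = (t ⊗ₘ I.wordAug (n + 1)) ≫ (λ_ (𝟙_ C)).hom

namespace PartialMul

variable {I} {M : C} {z : 𝟙_ C ⟶ M} {t : M ⟶ 𝟙_ C} {r : M ⊗ I.X ⟶ M}

/-- The action of zero and of the empty word. -/
lemma exists_zero (hzt : z ≫ t = 𝟙 (𝟙_ C))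
    (hz : z ▷ I.X ≫ r = (λ_ I.X).hom ≫ I.s ≫ z) :
    ∃ P : PartialMul I z t r 0, M ◁ I.wordOne ≫ P.f₁ = (ρ_ M).hom := by
  obtain ⟨f₁, hl, hr⟩ := I.exists_whiskerLeft_word_one ((ρ_ M).hom ≫ t ≫ z) (ρ_ M).hom
  refine ⟨⟨M ◁ I.wordAug 0 ≫ (ρ_ M).hom ≫ t ≫ z, f₁, ?_, ?_, ?_, ?_⟩, hr⟩
  · rw [← whiskerLeft_comp_assoc, wordZero_wordAug, whiskerLeft_id, Category.id_comp]
  · rw [← cancel_epi (M ◁ I.wordZero 0), ← whiskerLeft_comp_assoc, wordZero_wordIncl, hl,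
      ← whiskerLeft_comp_assoc, wordZero_wordAug, whiskerLeft_id, Category.id_comp]
  -- the only word of negative length is zero
  · rw [← cancel_epi (M ◁ (I.wordZero 0 ▷ I.X)), ← whiskerLeft_comp_assoc,
      wordZero_whiskerRight_wordMul, associator_inv_naturality_middle_assoc,
      ← comp_whiskerRight_assoc, ← whiskerLeft_comp_assoc, wordZero_wordAug, whiskerLeft_id,
      Category.id_comp, comp_whiskerRight_assoc, comp_whiskerRight_assoc, hz,
      triangle_assoc_comp_right_assoc, whiskerLeft_comp_assoc, whiskerLeft_comp_assoc, hl,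
      ← leftUnitor_naturality_assoc, ← whisker_exchange_assoc, unitors_equal,
      rightUnitor_naturality_assoc]
  · apply I.whiskerLeft_word_one_hom_ext
    · rw [reassoc_of% hl, hzt, whiskerLeft_comp_tensorHom_assoc, wordZero_wordAug]
      simp [unitors_equal]
    · rw [reassoc_of% hr, whiskerLeft_comp_tensorHom_assoc, wordOne_wordAug]
      simp [unitors_equal]

/-- The action of words extends to words longer by one letter. The augmentation enters because
multiplying by the letter `d₀` must agree with multiplying by zero. -/
lemma exists_succ
    (hr₀ : M ◁ I.d₀ ≫ r = (ρ_ M).hom ≫ t ≫ z) (hr₁ : M ◁ I.d₁ ≫ r = (ρ_ M).hom)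
    (hrt : r ≫ t = (t ⊗ₘ I.s) ≫ (λ_ (𝟙_ C)).hom) {n : ℕ}
    (P : PartialMul I z t r n) : ∃ Q : PartialMul I z t r (n + 1), Q.f₀ = P.f₁ := by
  have hz : M ◁ I.wordZero (n + 1) ≫ P.f₁ = (ρ_ M).hom ≫ t ≫ z := by
    rw [← wordZero_wordIncl, whiskerLeft_comp_assoc, P.incl, P.zero]
  obtain ⟨g, hg, hg'⟩ := I.exists_whiskerLeft_word n P.f₁
    ((α_ _ _ _).inv ≫ P.f₁ ▷ I.X ≫ r) (by
      rw [associator_inv_naturality_right_assoc, whisker_exchange_assoc, hr₀,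
        rightUnitor_naturality_assoc, reassoc_of% P.aug₁, whiskerLeft_comp_assoc,
        whiskerLeft_comp_assoc, hz,
        whiskerLeft_rightUnitor_assoc, tensorHom_def', Category.assoc,
        unitors_equal, rightUnitor_naturality_assoc]) (by
      rw [associator_inv_naturality_right_assoc, whisker_exchange_assoc, hr₁,
        rightUnitor_naturality, whiskerLeft_rightUnitor_assoc]) (by
      rw [associator_inv_naturality_middle_assoc, ← comp_whiskerRight_assoc, P.incl, P.mul])
  refine ⟨⟨P.f₁, g, hz, hg, hg', ?_⟩, rfl⟩
  apply I.whiskerLeft_word_hom_ext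
  · rw [reassoc_of% hg, P.aug₁, whiskerLeft_comp_tensorHom_assoc, wordIncl_wordAug]
  · rw [reassoc_of% hg', hrt, whiskerLeft_comp_tensorHom_assoc, wordMul_wordAug,
      whiskerRight_comp_tensorHom_assoc, P.aug₁, ← Category.comp_id I.s,
      ← tensorHom_comp_tensorHom_assoc, ← associator_inv_naturality_assoc,
      ← Category.comp_id t, ← tensorHom_comp_tensorHom_assoc]
    monoidal

end PartialMul
end Interval

end

/-! ### The James construction and its monoid structure -/

section

variable {C : Type u} [Category.{v} C] [MonoidalCategory C] [MonoidalClosed C]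
  [HasBinaryCoproducts C] [HasPushouts C] [HasColimitsOfShape ℕ C]

namespace Interval

variable (I : Interval C)

/-- The functor given by the word-length filtration. -/
noncomputable abbrev wordFunctor : ℕ ⥤ C := Functor.ofSequence I.wordIncl

/-- The James construction on the interval `X`, with unit `d₁` and zero `d₀`, as the union of its
word-length filtration. -/
noncomputable def James : C := colimit I.wordFunctor

noncomputable def ofWord (n : ℕ) : I.word n ⟶ I.James := colimit.ι I.wordFunctor n

lemma wordIncl_ofWord (n : ℕ) : I.wordIncl n ≫ I.ofWord (n + 1) = I.ofWord n := by
  have := colimit.w I.wordFunctor (homOfLE (Nat.le_add_right n 1))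
  rwa [Functor.ofSequence_map_homOfLE_succ] at this

section

variable {I}

/-- The cocone over the filtration given by a sequence of compatible maps. -/
noncomputable def wordCocone {F : C ⥤ C} {W : C} (f : ∀ n, F.obj (I.word n) ⟶ W)
    (hf : ∀ n, F.map (I.wordIncl n) ≫ f (n + 1) = f n) : Cocone (I.wordFunctor ⋙ F) where
  pt := W
  ι := NatTrans.ofSequence f (fun n ↦ by
    refine Eq.trans ?_ (Category.comp_id _).symm
    rw [← hf n, Functor.comp_map, Functor.ofSequence_map_homOfLE_succ]
    rfl)

lemma map_james_hom_ext (F : C ⥤ C) [PreservesColimitsOfShape ℕ F] {W : C}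
    {f g : F.obj I.James ⟶ W} (h : ∀ n, F.map (I.ofWord n) ≫ f = F.map (I.ofWord n) ≫ g) :
    f = g :=
  (isColimitOfPreserves F (colimit.isColimit I.wordFunctor)).hom_ext h

lemma james_whiskerLeft_hom_ext {A W : C} {f g : A ⊗ I.James ⟶ W}
    (h : ∀ n, A ◁ I.ofWord n ≫ f = A ◁ I.ofWord n ≫ g) : f = g :=
  map_james_hom_ext (tensorLeft A) h

lemma exists_map_james_desc (F : C ⥤ C) [PreservesColimitsOfShape ℕ F] {W : C}
    (f : ∀ n, F.obj (I.word n) ⟶ W) (hf : ∀ n, F.map (I.wordIncl n) ≫ f (n + 1) = f n) :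
    ∃ g : F.obj I.James ⟶ W, ∀ n, F.map (I.ofWord n) ≫ g = f n :=
  ⟨(isColimitOfPreserves F (colimit.isColimit I.wordFunctor)).desc (wordCocone f hf),
    (isColimitOfPreserves F (colimit.isColimit I.wordFunctor)).fac (wordCocone f hf)⟩

end

lemma exists_jamesAug : ∃ t : I.James ⟶ 𝟙_ C, ∀ n, I.ofWord n ≫ t = I.wordAug n :=
  exists_map_james_desc (𝟭 C) I.wordAug I.wordIncl_wordAug

/-- The augmentation of the James construction. -/
noncomputable def jamesAug : I.James ⟶ 𝟙_ C := I.exists_jamesAug.choose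

lemma ofWord_jamesAug (n : ℕ) : I.ofWord n ≫ I.jamesAug = I.wordAug n :=
  I.exists_jamesAug.choose_spec n

noncomputable def jamesZero : 𝟙_ C ⟶ I.James := I.wordZero 0 ≫ I.ofWord 0

noncomputable def jamesOne : 𝟙_ C ⟶ I.James := I.wordOne ≫ I.ofWord 1

lemma wordZero_ofWord (n : ℕ) : I.wordZero n ≫ I.ofWord n = I.jamesZero := by
  induction n with
  | zero => rfl
  | succ n hn => rw [← hn, ← wordZero_wordIncl, Category.assoc, wordIncl_ofWord]

lemma jamesZero_jamesAug : I.jamesZero ≫ I.jamesAug = 𝟙 (𝟙_ C) := by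
  rw [jamesZero, Category.assoc, ofWord_jamesAug, wordZero_wordAug]

lemma jamesOne_jamesAug : I.jamesOne ≫ I.jamesAug = 𝟙 (𝟙_ C) := by
  rw [jamesOne, Category.assoc, ofWord_jamesAug, wordOne_wordAug]

variable [BraidedCategory C]

lemma exists_jamesAct : ∃ r : I.James ⊗ I.X ⟶ I.James,
    ∀ n, I.ofWord n ▷ I.X ≫ r = I.wordMul n ≫ I.ofWord (n + 1) :=
  exists_map_james_desc (tensorRight I.X) (fun n ↦ I.wordMul n ≫ I.ofWord (n + 1)) (fun n ↦ by
    change I.wordIncl n ▷ I.X ≫ _ = _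
    rw [← Category.assoc, wordIncl_whiskerRight_wordMul, Category.assoc, wordIncl_ofWord])

/-- The right action of the letters on the James construction. -/
noncomputable def jamesAct : I.James ⊗ I.X ⟶ I.James := I.exists_jamesAct.choose

lemma ofWord_whiskerRight_jamesAct (n : ℕ) :
    I.ofWord n ▷ I.X ≫ I.jamesAct = I.wordMul n ≫ I.ofWord (n + 1) :=
  I.exists_jamesAct.choose_spec n

section

variable {I}

lemma james_whiskerRight_hom_ext {A W : C} {f g : I.James ⊗ A ⟶ W}
    (h : ∀ n, I.ofWord n ▷ A ≫ f = I.ofWord n ▷ A ≫ g) : f = g :=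
  map_james_hom_ext (tensorRight A) h

end

lemma whiskerLeft_d₁_jamesAct : I.James ◁ I.d₁ ≫ I.jamesAct = (ρ_ I.James).hom := by
  apply james_whiskerRight_hom_ext
  intro n
  rw [← whisker_exchange_assoc, ofWord_whiskerRight_jamesAct, reassoc_of%
    I.whiskerLeft_d₁_wordMul, wordIncl_ofWord, rightUnitor_naturality]

lemma whiskerLeft_d₀_jamesAct :
    I.James ◁ I.d₀ ≫ I.jamesAct = (ρ_ I.James).hom ≫ I.jamesAug ≫ I.jamesZero := by
  apply james_whiskerRight_hom_ext
  intro n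
  rw [← whisker_exchange_assoc, ofWord_whiskerRight_jamesAct, reassoc_of%
    I.whiskerLeft_d₀_wordMul, wordZero_ofWord, rightUnitor_naturality_assoc, reassoc_of%
    I.ofWord_jamesAug]

lemma jamesAct_jamesAug :
    I.jamesAct ≫ I.jamesAug = (I.jamesAug ⊗ₘ I.s) ≫ (λ_ (𝟙_ C)).hom := by
  apply james_whiskerRight_hom_ext
  intro n
  rw [reassoc_of% I.ofWord_whiskerRight_jamesAct, ofWord_jamesAug, wordMul_wordAug,
    whiskerRight_comp_tensorHom_assoc, ofWord_jamesAug]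

lemma jamesZero_whiskerRight_jamesAct :
    I.jamesZero ▷ I.X ≫ I.jamesAct = (λ_ I.X).hom ≫ I.s ≫ I.jamesZero := by
  rw [jamesZero, comp_whiskerRight_assoc, ofWord_whiskerRight_jamesAct, reassoc_of%
    I.wordZero_whiskerRight_wordMul, wordZero_ofWord, ← jamesZero]

/-- Two maps out of `A ⊗ James` that are compatible with the action of the letters agree if they
agree on zero and on the empty word. -/
lemma james_induction {A W : C} {r : W ⊗ I.X ⟶ W} {f g : A ⊗ I.James ⟶ W}
    (h₀ : A ◁ I.jamesZero ≫ f = A ◁ I.jamesZero ≫ g)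
    (h₁ : A ◁ I.jamesOne ≫ f = A ◁ I.jamesOne ≫ g)
    (hf : A ◁ I.jamesAct ≫ f = (α_ _ _ _).inv ≫ f ▷ I.X ≫ r)
    (hg : A ◁ I.jamesAct ≫ g = (α_ _ _ _).inv ≫ g ▷ I.X ≫ r) : f = g := by
  have step : ∀ n, A ◁ I.ofWord (n + 1) ≫ f = A ◁ I.ofWord (n + 1) ≫ g := by
    intro n
    induction n with
    | zero =>
      apply I.whiskerLeft_word_one_hom_ext
      · rwa [← whiskerLeft_comp_assoc, ← whiskerLeft_comp_assoc, wordZero_ofWord]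
      · rwa [← whiskerLeft_comp_assoc, ← whiskerLeft_comp_assoc]
    | succ n hn =>
      have key : ∀ k : A ⊗ I.James ⟶ W,
          A ◁ I.jamesAct ≫ k = (α_ _ _ _).inv ≫ k ▷ I.X ≫ r →
          A ◁ I.wordMul (n + 1) ≫ A ◁ I.ofWord (n + 1 + 1) ≫ k =
            (α_ _ _ _).inv ≫ (A ◁ I.ofWord (n + 1) ≫ k) ▷ I.X ≫ r := by
        intro k hk
        rw [← whiskerLeft_comp_assoc, ← ofWord_whiskerRight_jamesAct, whiskerLeft_comp_assoc, hk,
          associator_inv_naturality_middle_assoc, comp_whiskerRight_assoc]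
      apply I.whiskerLeft_word_hom_ext
      · rwa [← whiskerLeft_comp_assoc, ← whiskerLeft_comp_assoc, wordIncl_ofWord]
      · rw [key f hf, key g hg, hn]
  apply james_whiskerLeft_hom_ext
  intro n
  rw [← wordIncl_ofWord, whiskerLeft_comp_assoc, whiskerLeft_comp_assoc, step]

/-- The partial products of an element of the James construction by words of bounded length. -/
noncomputable abbrev JamesPartialMul (n : ℕ) : Type v :=
  I.PartialMul I.jamesZero I.jamesAug I.jamesAct n

lemma exists_partialMul_zero :
    ∃ P : I.JamesPartialMul 0, I.James ◁ I.wordOne ≫ P.f₁ = (ρ_ I.James).hom :=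
  PartialMul.exists_zero I.jamesZero_jamesAug I.jamesZero_whiskerRight_jamesAct

lemma exists_partialMul_succ {n : ℕ} (P : I.JamesPartialMul n) :
    ∃ Q : I.JamesPartialMul (n + 1), Q.f₀ = P.f₁ :=
  P.exists_succ I.whiskerLeft_d₀_jamesAct I.whiskerLeft_d₁_jamesAct I.jamesAct_jamesAug

/-- A compatible choice of partial products, for all word lengths. -/
noncomputable def partialMul : (n : ℕ) → I.JamesPartialMul n
  | 0 => I.exists_partialMul_zero.choose
  | n + 1 => (I.exists_partialMul_succ (partialMul n)).choose

lemma partialMul_succ (n : ℕ) : (I.partialMul (n + 1)).f₀ = (I.partialMul n).f₁ :=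
  (I.exists_partialMul_succ (I.partialMul n)).choose_spec

lemma exists_jamesMul : ∃ μ : I.James ⊗ I.James ⟶ I.James,
    ∀ n, I.James ◁ I.ofWord n ≫ μ = (I.partialMul n).f₀ :=
  exists_map_james_desc (tensorLeft I.James) (fun n ↦ (I.partialMul n).f₀) (fun n ↦ by
    change I.James ◁ I.wordIncl n ≫ _ = _
    rw [partialMul_succ, PartialMul.incl])

/-- The multiplication of the James construction: multiplying by a word is multiplying by its
letters one after the other. -/
noncomputable def jamesMul : I.James ⊗ I.James ⟶ I.James := I.exists_jamesMul.choose

lemma whiskerLeft_ofWord_jamesMul (n : ℕ) :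
    I.James ◁ I.ofWord n ≫ I.jamesMul = (I.partialMul n).f₀ :=
  I.exists_jamesMul.choose_spec n

lemma whiskerLeft_jamesZero_jamesMul :
    I.James ◁ I.jamesZero ≫ I.jamesMul = (ρ_ I.James).hom ≫ I.jamesAug ≫ I.jamesZero := by
  rw [← I.wordZero_ofWord 0, whiskerLeft_comp_assoc, whiskerLeft_ofWord_jamesMul, PartialMul.zero,
    wordZero_ofWord]

lemma whiskerLeft_jamesOne_jamesMul :
    I.James ◁ I.jamesOne ≫ I.jamesMul = (ρ_ I.James).hom := by
  rw [jamesOne, whiskerLeft_comp_assoc, whiskerLeft_ofWord_jamesMul, partialMul_succ]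
  exact I.exists_partialMul_zero.choose_spec

lemma whiskerLeft_jamesAct_jamesMul : I.James ◁ I.jamesAct ≫ I.jamesMul =
    (α_ _ _ _).inv ≫ I.jamesMul ▷ I.X ≫ I.jamesAct := by
  apply map_james_hom_ext (tensorRight I.X ⋙ tensorLeft I.James)
  intro n
  change I.James ◁ (I.ofWord n ▷ I.X) ≫ _ = I.James ◁ (I.ofWord n ▷ I.X) ≫ _
  rw [← whiskerLeft_comp_assoc, ofWord_whiskerRight_jamesAct, whiskerLeft_comp_assoc,
    whiskerLeft_ofWord_jamesMul, partialMul_succ, PartialMul.mul,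
    associator_inv_naturality_middle_assoc, ← comp_whiskerRight_assoc,
    whiskerLeft_ofWord_jamesMul]

lemma jamesMul_jamesAug :
    I.jamesMul ≫ I.jamesAug = (I.jamesAug ⊗ₘ I.jamesAug) ≫ (λ_ (𝟙_ C)).hom := by
  apply james_whiskerLeft_hom_ext
  intro n
  rw [← wordIncl_ofWord, whiskerLeft_comp_assoc, whiskerLeft_comp_assoc,
    reassoc_of% I.whiskerLeft_ofWord_jamesMul, partialMul_succ, PartialMul.aug₁,
    whiskerLeft_comp_tensorHom_assoc, whiskerLeft_comp_tensorHom_assoc,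
    whiskerLeft_comp_tensorHom_assoc, ofWord_jamesAug, wordIncl_wordAug]

lemma jamesOne_whiskerRight_jamesMul :
    I.jamesOne ▷ I.James ≫ I.jamesMul = (λ_ I.James).hom := by
  apply I.james_induction (r := I.jamesAct)
  · rw [whisker_exchange_assoc, whiskerLeft_jamesZero_jamesMul, rightUnitor_naturality_assoc,
      reassoc_of% I.jamesOne_jamesAug, leftUnitor_naturality, unitors_equal]
  · rw [whisker_exchange_assoc, whiskerLeft_jamesOne_jamesMul, rightUnitor_naturality,
      leftUnitor_naturality, unitors_equal]
  · rw [whisker_exchange_assoc, whiskerLeft_jamesAct_jamesMul, comp_whiskerRight_assoc,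
      associator_inv_naturality_left_assoc]
  · rw [leftUnitor_naturality, leftUnitor_whiskerRight_assoc, Iso.inv_hom_id_assoc]

lemma jamesZero_whiskerRight_jamesMul :
    I.jamesZero ▷ I.James ≫ I.jamesMul = (λ_ I.James).hom ≫ I.jamesAug ≫ I.jamesZero := by
  apply I.james_induction (r := I.jamesAct)
  · rw [whisker_exchange_assoc, whiskerLeft_jamesZero_jamesMul, rightUnitor_naturality_assoc,
      leftUnitor_naturality_assoc, unitors_equal]
  · rw [whisker_exchange_assoc, whiskerLeft_jamesOne_jamesMul, rightUnitor_naturality,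
      leftUnitor_naturality_assoc, unitors_equal, reassoc_of% I.jamesOne_jamesAug]
  · rw [whisker_exchange_assoc, whiskerLeft_jamesAct_jamesMul, comp_whiskerRight_assoc,
      associator_inv_naturality_left_assoc]
  · rw [leftUnitor_naturality_assoc, reassoc_of% I.jamesAct_jamesAug, comp_whiskerRight_assoc,
      comp_whiskerRight_assoc, jamesZero_whiskerRight_jamesAct, leftUnitor_whiskerRight_assoc,
      Iso.inv_hom_id_assoc, tensorHom_def_assoc, leftUnitor_naturality_assoc]

/-- Associativity, by induction on the length of the third factor. -/
lemma jamesMul_assoc : I.jamesMul ▷ I.James ≫ I.jamesMul =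
    (α_ _ _ _).hom ≫ I.James ◁ I.jamesMul ≫ I.jamesMul := by
  apply I.james_induction (r := I.jamesAct)
  · rw [whisker_exchange_assoc, whiskerLeft_jamesZero_jamesMul, rightUnitor_naturality_assoc,
      reassoc_of% I.jamesMul_jamesAug, associator_naturality_right_assoc, ← whiskerLeft_comp_assoc,
      whiskerLeft_jamesZero_jamesMul, whiskerLeft_comp_assoc, whiskerLeft_comp_assoc,
      whiskerLeft_jamesZero_jamesMul]
    rw [whiskerLeft_rightUnitor_assoc, Iso.hom_inv_id_assoc, tensorHom_def', Category.assoc,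
      unitors_equal, rightUnitor_naturality_assoc]
  · rw [whisker_exchange_assoc, whiskerLeft_jamesOne_jamesMul, rightUnitor_naturality,
      associator_naturality_right_assoc, ← whiskerLeft_comp_assoc,
      whiskerLeft_jamesOne_jamesMul, whiskerLeft_rightUnitor_assoc, Iso.hom_inv_id_assoc]
  · rw [whisker_exchange_assoc, whiskerLeft_jamesAct_jamesMul, comp_whiskerRight_assoc,
      associator_inv_naturality_left_assoc]
  · rw [associator_naturality_right_assoc, ← whiskerLeft_comp_assoc,
      whiskerLeft_jamesAct_jamesMul, whiskerLeft_comp_assoc, whiskerLeft_comp_assoc,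
      whiskerLeft_jamesAct_jamesMul, associator_inv_naturality_middle_assoc,
      comp_whiskerRight_assoc, comp_whiskerRight_assoc]
    monoidal

/-- The James construction on an interval as a cubical monoid. -/
noncomputable def jamesMonoid : CubicalMonoid C where
  X := I.James
  d₀ := I.jamesZero
  d₁ := I.jamesOne
  s := I.jamesAug
  μ := I.jamesMul
  d₀_s := I.jamesZero_jamesAug
  d₁_s := I.jamesOne_jamesAug
  one_mul := I.jamesOne_whiskerRight_jamesMul
  mul_one := I.whiskerLeft_jamesOne_jamesMul
  mul_assoc := I.jamesMul_assoc
  mul_s := I.jamesMul_jamesAug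
  mul_d₀ := by
    rw [whiskerLeft_jamesZero_jamesMul, unitors_equal, rightUnitor_naturality_assoc]
  d₀_mul := by
    rw [jamesZero_whiskerRight_jamesMul, leftUnitor_naturality_assoc]

end Interval

end

/-! ### Homotopical properties -/

/-- The maps from the terms of a transfinite composition of left-lifting maps to its colimit have
the same left lifting property. -/
lemma llp_incl_app {C : Type u} [Category.{v} C] {W : MorphismProperty C}
    {J : Type*} [LinearOrder J] [SuccOrder J] [OrderBot J] [WellFoundedLT J]
    {X Y : C} {f : X ⟶ Y} (h : W.llp.TransfiniteCompositionOfShape J f) (j : J) :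
    W.llp (h.incl.app j) :=
  MorphismProperty.transfiniteCompositionsOfShape_le _ _ _ (h.ici j).mem

/-- The unit object has a cylinder, by factoring the codiagonal. -/
lemma exists_interval {C : Type u} [Category.{v} C] [MonoidalCategory C] [ModelCategory C] :
    ∃ I : Interval C, Cofibration (coprod.desc I.d₀ I.d₁) ∧ WeakEquivalence I.s := by
  let h := MorphismProperty.factorizationData (cofibrations C) (trivialFibrations C)
    (coprod.desc (𝟙 (𝟙_ C)) (𝟙 (𝟙_ C)))
  refine ⟨⟨h.Z, coprod.inl ≫ h.i, coprod.inr ≫ h.i, h.p,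
    by rw [Category.assoc, h.fac, coprod.inl_desc],
    by rw [Category.assoc, h.fac, coprod.inr_desc]⟩, ?_, ?_⟩
  · have hi : coprod.desc (coprod.inl ≫ h.i) (coprod.inr ≫ h.i) = h.i := by
      apply coprod.hom_ext
      · rw [coprod.inl_desc]
      · rw [coprod.inr_desc]
    change Cofibration (coprod.desc (coprod.inl ≫ h.i) (coprod.inr ≫ h.i))
    rw [hi]
    infer_instance
  · exact inferInstanceAs (WeakEquivalence h.p)

section

variable {C : Type u} [Category.{v} C] [MonoidalCategory C] [MonoidalClosed C] [ModelCategory C]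

namespace Interval

lemma cofibration_ofWord [HasColimitsOfShape ℕ C] [PushoutProductAxiom C] [IsCofibrant (𝟙_ C)]
    (I : Interval C) [Cofibration (coprod.desc I.d₀ I.d₁)] (n : ℕ) :
    Cofibration (I.ofWord n) := by
  let h : (trivialFibrations C).llp.TransfiniteCompositionOfShape ℕ (colimit.ι I.wordFunctor 0) :=
    { F := I.wordFunctor
      isoBot := Iso.refl _
      incl := (colimit.cocone I.wordFunctor).ι
      isColimit := colimit.isColimit I.wordFunctor
      map_mem k _ := by
        rw [trivialFibrations_llp]
        change cofibrations C (I.wordFunctor.map (homOfLE (Nat.le_add_right k 1)))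
        rw [Functor.ofSequence_map_homOfLE_succ]
        exact (I.cofibration_wordIncl k).mem }
  have hn : (trivialFibrations C).llp (I.ofWord n) := llp_incl_app h n
  rw [trivialFibrations_llp] at hn
  exact ⟨hn⟩

lemma desc_jamesZero_jamesOne [HasColimitsOfShape ℕ C] (I : Interval C) :
    coprod.desc I.jamesZero I.jamesOne = I.ofWord 1 := by
  apply coprod.hom_ext
  · rw [coprod.inl_desc, ← I.wordZero_ofWord 1, wordZero_one]
    rfl
  · rw [coprod.inr_desc]
    rfl

end Interval

/-- Tensoring a trivial cofibration with a cofibrant object gives a weak equivalence. -/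
lemma weakEquivalence_whiskerLeft [BraidedCategory C] [PushoutProductAxiom C] (M : C)
    [IsCofibrant M] {A B : C} (d : A ⟶ B) [Cofibration d] [WeakEquivalence d] :
    WeakEquivalence (M ◁ d) := by
  have hI (Z : C) : IsInitial ((⊥_ C) ⊗ Z) := initialIsInitial.isInitialObj (tensorRight Z) _
  have : IsIso ((⊥_ C) ◁ d) := isIso_of_isInitial (hI A) (hI B) _
  have h : pushout.inl _ _ ≫ pushoutProductMap (initial.to M) d = M ◁ d := pushout.inl_desc _ _ _
  have := PushoutProductAxiom.weakEquivalence_right (initial.to M) d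
  rw [← h]
  infer_instance

/-- If `M` is cofibrant and the identity of `M` is homotopic to an endomorphism that factors
through `e`, by a homotopy parametrized by an interval weakly equivalent to `e`, then the
augmentation of `M` is a weak equivalence. -/
lemma weakEquivalence_of_interval_homotopy [BraidedCategory C] [PushoutProductAxiom C]
    (I : Interval C) {M : C} [IsCofibrant M] [Cofibration I.d₀] [Cofibration I.d₁]
    [WeakEquivalence I.s] {z : 𝟙_ C ⟶ M} {t : M ⟶ 𝟙_ C} (hzt : z ≫ t = 𝟙 (𝟙_ C))
    {r : M ⊗ I.X ⟶ M} (h₁ : M ◁ I.d₁ ≫ r = (ρ_ M).hom)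
    (h₀ : M ◁ I.d₀ ≫ r = (ρ_ M).hom ≫ t ≫ z) : WeakEquivalence t := by
  have : WeakEquivalence I.d₀ := weakEquivalence_of_postcomp_of_fac I.d₀_s
  have : WeakEquivalence I.d₁ := weakEquivalence_of_postcomp_of_fac I.d₁_s
  have := weakEquivalence_whiskerLeft M I.d₀
  have := weakEquivalence_whiskerLeft M I.d₁
  have : WeakEquivalence r := weakEquivalence_of_precomp_of_fac h₁
  -- the other end of the homotopy `r`
  have htz : WeakEquivalence (t ≫ z) := by
    have : WeakEquivalence ((ρ_ M).hom ≫ t ≫ z) := by rw [← h₀]; infer_instance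
    exact weakEquivalence_of_precomp (ρ_ M).hom (t ≫ z)
  -- since `z ≫ t` is the identity, `t` is a retract of `t ≫ z`
  have hr : RetractArrow t (t ≫ z) :=
    { i := Arrow.homMk (𝟙 M) z (by simp)
      r := Arrow.homMk (𝟙 M) t (by simp [hzt])
      retract := by ext <;> simp [hzt] }
  exact ⟨MorphismProperty.of_retract hr htz.mem⟩

end

end CubicalModel

theorem mainTheorem3 {C : Type u} [Category.{v} C] [MonoidalCategory C] [SymmetricCategory C]
    [MonoidalClosed C] [ModelCategory C] [CubicalModel.PushoutProductAxiom C]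
    [CubicalModel.IsCombinatorial C] [CubicalModel.MonoidAxiom C]
    (he : IsCofibrant (𝟙_ C)) :
    ∃ I : CubicalModel.CubicalMonoid C,
      Cofibration (coprod.desc I.d₀ I.d₁ : 𝟙_ C ⨿ 𝟙_ C ⟶ I.X) ∧ WeakEquivalence I.s := by
  obtain ⟨I, hI, hs⟩ := CubicalModel.exists_interval (C := C)
  have : HasColimitsOfShape ℕ C := by
    obtain ⟨κ, _, _⟩ := IsLocallyPresentable.exists_cardinal.{v} C
    have := hasColimitsOfSizeShrink.{0, 0, v, v} C
    infer_instance
  have h₀ : Cofibration I.d₀ := by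
    rw [← coprod.inl_desc I.d₀ I.d₁]
    infer_instance
  have h₁ : Cofibration I.d₁ := by
    rw [← coprod.inr_desc I.d₀ I.d₁]
    infer_instance
  have := I.cofibration_ofWord
  have : IsCofibrant I.James := isCofibrant_of_cofibration (I.ofWord 0)
    (hX := inferInstanceAs (IsCofibrant (𝟙_ C)))
  refine ⟨I.jamesMonoid, ?_, ?_⟩
  · change Cofibration (coprod.desc I.jamesZero I.jamesOne)
    rw [I.desc_jamesZero_jamesOne]
    exact I.cofibration_ofWord 1
  · change WeakEquivalence I.jamesAug
    exact CubicalModel.weakEquivalence_of_interval_homotopy I I.jamesZero_jamesAug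
      I.whiskerLeft_d₁_jamesAct I.whiskerLeft_d₀_jamesAct
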